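/- Let $d\ge 1$ and $\alpha\in\mathbb R$. For an open set $\Omega\subseteq\mathbb R^d$ let $\mathcal G(\Omega)=\mathcal E_M(\Omega)/\mathcal N(\Omega)$ be the special Colombeau algebra: $\mathcal E_M(\Omega)$ is the algebra of nets $(u_\varepsilon)_{\varepsilon\in(0,1]}$ of smooth functions $u_\varepsilon:\Omega\to\mathbb C$ such that for every compact $L\subset\Omega$ and every $\beta\in\mathbb N_0^d$ there is $N\ge 0$ with $\sup_{x\in L}|\partial^\beta u_\varepsilon(x)|=O(\varepsilon^{-N})$ as $\varepsilon\to0$, and $\mathcal N(\Omega)$ is the ideal of those nets for which $\sup_{x\in L}|\partial^\beta u_\varepsilon(x)|=O(\varepsilon^{m})$ for all compact $L\subset\Omega$, all $\beta$ and all $m\ge 0$. Composition with smooth maps and multiplication are defined componentwise on representatives. Let $\mathcal G_\tau(\mathbb R^d)=\mathcal E_{M,\tau}(\mathbb R^d)/\mathcal N_\tau(\mathbb R^d)$ be the algebra of tempered generalized functions: $\mathcal E_{M,\tau}(\mathbb R^d)$ consists of the nets of smooth functions such that for every $\beta$ there is $N\geq 0$ with $\sup_{x\in\mathbb R^d}(1+|x|)^{-N}|\partial^\beta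 u_\varepsilon(x)|=O(\varepsilon^{-N})$, and $\mathcal N_\tau(\mathbb R^d)$ of those such that for every $\beta$ there is $N\geq 0$ such that for all $p\geq 0$, $\sup_{x\in\mathbb R^d}(1+|x|)^{-N}|\partial^\beta u_\varepsilon(x)|=O(\varepsilon^{p})$. Let $K:\mathcal G_\tau(\mathbb R^d)\to\mathcal G(\mathbb R^d)$, $(u_\varepsilon)_\varepsilon+\mathcal N_\tau(\mathbb R^d)\mapsto(u_\varepsilon)_\varepsilon+\mathcal N(\mathbb R^d)$, be the canonical map. For $\Omega=\mathbb R^d$ or $\Omega=\mathbb R^d\setminus\{0\}$, $u\in\mathcal G(\Omega)$ is called homogeneous of degree $\alpha$ if for each real $\lambda>0$ the equality $u(\lambda x)=\lambda^\alpha u(x)$ holds in $\mathcal G(\Omega)$. 1. If $u\in\mathcal G(\mathbb R^d\setminus\{0\})$ is homogeneous of degree $\alpha$, then $u(x)=u\big(\tfrac{x}{|x|}\big)|x|^\alpha$ holds in $\mathcal G(\mathbb R^d\setminus\{0\})$. 2. If $u\in\mathcal G(\mathbb R^d)$ is homogeneous of degree $\alpha$, then there exists $v\in\mathcal G_\tau(\mathbb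 R^d)$ with $K(v)=u$. -/

import Mathlib

open Filter Topology TopologicalSpace
open scoped ContDiff

noncomputable section

namespace Colombeau

/-- Euclidean space `ℝ^d`, with the Euclidean norm. -/
abbrev Eu (d : ℕ) : Type := EuclideanSpace ℝ (Fin d)

/-- The index set `(0,1]` of the regularisation parameter `ε`. -/
abbrev Idx : Type := Set.Ioc (0 : ℝ) 1

/-- The filter `ε → 0` on `(0,1]`. -/
def toZero : Filter Idx := comap (fun ε : Idx => (ε : ℝ)) (𝓝 0)

/-- Nets `(u_ε)` of complex valued functions. In everything that follows only the values on an open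
set `Ω` matter; a smooth function on `Ω` is represented by any extension of it to `ℝ^d` by arbitrary
values, and the ideals of negligible nets identify all extensions of the same net. -/
abbrev Net (d : ℕ) : Type := Idx → Eu d → ℂ

/-- `‖D^n u_ε(x)‖ = O(ρ(ε, x))` as `ε → 0`, uniformly for `x ∈ S`. Here `D^n u_ε` is the `n`-th total
derivative in the open set `Ω`, whose norm is equivalent to the maximum of the
absolute values of the partial derivatives `∂^β u_ε`, `|β| = n`. -/
def HasBound {d : ℕ} (Ω : Opens (Eu d)) (S : Set (Eu d)) (n : ℕ) (ρ : Idx → Eu d → ℝ)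
    (u : Net d) : Prop :=
  ∃ C : ℝ, ∀ᶠ ε in toZero, ∀ x ∈ S,
    ‖iteratedFDerivWithin ℝ n (u ε) (Ω : Set (Eu d)) x‖ ≤ C * ρ ε x

/-- Each member of the net is `C^∞` on `Ω`. -/
def IsSmoothNet {d : ℕ} (Ω : Opens (Eu d)) (u : Net d) : Prop :=
  ∀ ε, ContDiffOn ℝ ∞ (u ε) (Ω : Set (Eu d))

/-- Moderate nets: on each compact subset of `Ω` every derivative is `O(ε^{-N})` for some `N`. -/
def IsModerate {d : ℕ} (Ω : Opens (Eu d)) (u : Net d) : Prop :=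
  IsSmoothNet Ω u ∧ ∀ S : Set (Eu d), IsCompact S → S ⊆ Ω → ∀ n : ℕ, ∃ N : ℕ,
    HasBound Ω S n (fun ε _ => ((ε : ℝ) ^ N)⁻¹) u

/-- Negligible nets: on each compact subset of `Ω` every derivative is `O(ε^m)` for all `m`. -/
def IsNegligible {d : ℕ} (Ω : Opens (Eu d)) (u : Net d) : Prop :=
  IsSmoothNet Ω u ∧ ∀ S : Set (Eu d), IsCompact S → S ⊆ Ω → ∀ n m : ℕ,
    HasBound Ω S n (fun ε _ => (ε : ℝ) ^ m) u

/-- Tempered moderate nets: each derivative is `O(ε^{-N} (1 + |x|)^N)` on `Ω` for some `N`. -/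
def IsTemperedModerate {d : ℕ} (Ω : Opens (Eu d)) (u : Net d) : Prop :=
  IsSmoothNet Ω u ∧ ∀ n : ℕ, ∃ N : ℕ,
    HasBound Ω Ω n (fun ε x => ((ε : ℝ) ^ N)⁻¹ * (1 + ‖x‖) ^ N) u

/-- Tempered negligible nets: for each derivative there is an `N` such that it is
`O(ε^p (1 + |x|)^N)` on `Ω` for all `p`. -/
def IsTemperedNegligible {d : ℕ} (Ω : Opens (Eu d)) (u : Net d) : Prop :=
  IsSmoothNet Ω u ∧ ∀ n : ℕ, ∃ N : ℕ, ∀ p : ℕ,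
    HasBound Ω Ω n (fun ε x => (ε : ℝ) ^ p * (1 + ‖x‖) ^ N) u

section Estimates

theorem idx_pow_le (ε : Idx) {N M : ℕ} (h : N ≤ M) : (ε : ℝ) ^ M ≤ (ε : ℝ) ^ N :=
  pow_le_pow_of_le_one ε.2.1.le ε.2.2 h

theorem idx_inv_pow_le (ε : Idx) {N M : ℕ} (h : N ≤ M) :
    ((ε : ℝ) ^ N)⁻¹ ≤ ((ε : ℝ) ^ M)⁻¹ :=
  inv_anti₀ (pow_pos ε.2.1 _) (idx_pow_le ε h)

theorem exists_uniform {P : ℕ → ℕ → Prop} (mono : ∀ i N M, N ≤ M → P i N → P i M)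
    (h : ∀ i, ∃ N, P i N) (n : ℕ) : ∃ N, ∀ i, i ≤ n → P i N := by
  choose f hf using h
  refine ⟨(Finset.range (n + 1)).sup f, fun i hi => mono i _ _ ?_ (hf i)⟩
  exact Finset.le_sup (f := f) (Finset.mem_range.2 (by omega))

variable {d : ℕ} {Ω : Opens (Eu d)} {S : Set (Eu d)} {n : ℕ} {ρ ρ' : Idx → Eu d → ℝ}
  {u v : Net d}

theorem HasBound.mono (h : HasBound Ω S n ρ u) (h0 : ∀ ε, ∀ x ∈ S, 0 ≤ ρ ε x)
    (hle : ∀ ε, ∀ x ∈ S, ρ ε x ≤ ρ' ε x) : HasBound Ω S n ρ' u := by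
  obtain ⟨C, hC⟩ := h
  refine ⟨|C|, hC.mono fun ε hε x hx => (hε x hx).trans ?_⟩
  calc C * ρ ε x ≤ |C| * ρ ε x := mul_le_mul_of_nonneg_right (le_abs_self C) (h0 ε x hx)
    _ ≤ |C| * ρ' ε x := mul_le_mul_of_nonneg_left (hle ε x hx) (abs_nonneg C)

theorem HasBound.add (hS : S ⊆ Ω) (hu : IsSmoothNet Ω u) (hv : IsSmoothNet Ω v)
    (h : HasBound Ω S n ρ u) (h' : HasBound Ω S n ρ v) : HasBound Ω S n ρ (u + v) := by
  obtain ⟨C, hC⟩ := h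
  obtain ⟨C', hC'⟩ := h'
  refine ⟨C + C', ?_⟩
  filter_upwards [hC, hC'] with ε h1 h2 x hx
  have hx' : x ∈ (Ω : Set (Eu d)) := hS hx
  rw [Pi.add_apply, iteratedFDerivWithin_add_apply
    (((hu ε) x hx').of_le (by exact_mod_cast le_top))
    (((hv ε) x hx').of_le (by exact_mod_cast le_top)) Ω.isOpen.uniqueDiffOn hx', add_mul]
  exact (norm_add_le _ _).trans (add_le_add (h1 x hx) (h2 x hx))

theorem HasBound.mul (hS : S ⊆ Ω) (hu : IsSmoothNet Ω u) (hv : IsSmoothNet Ω v)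
    (h0 : ∀ ε, ∀ x ∈ S, 0 ≤ ρ ε x)
    (h : ∀ i, i ≤ n → HasBound Ω S i ρ u) (h' : ∀ i, i ≤ n → HasBound Ω S i ρ' v) :
    HasBound Ω S n (fun ε x => ρ ε x * ρ' ε x) (u * v) := by
  have H : ∀ i, ∃ C : ℝ, i ≤ n → ∀ᶠ ε in toZero, ∀ x ∈ S,
      ‖iteratedFDerivWithin ℝ i (u ε) (Ω : Set (Eu d)) x‖ ≤ C * ρ ε x := by
    intro i
    by_cases hi : i ≤ n
    · obtain ⟨C, hC⟩ := h i hi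
      exact ⟨C, fun _ => hC⟩
    · exact ⟨0, fun hi' => absurd hi' hi⟩
  have H' : ∀ i, ∃ C : ℝ, i ≤ n → ∀ᶠ ε in toZero, ∀ x ∈ S,
      ‖iteratedFDerivWithin ℝ i (v ε) (Ω : Set (Eu d)) x‖ ≤ C * ρ' ε x := by
    intro i
    by_cases hi : i ≤ n
    · obtain ⟨C, hC⟩ := h' i hi
      exact ⟨C, fun _ => hC⟩
    · exact ⟨0, fun hi' => absurd hi' hi⟩
  choose C hC using H
  choose C' hC' using H'
  have A : ∀ᶠ ε in toZero, ∀ i ∈ Finset.range (n + 1), ∀ x ∈ S,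
      ‖iteratedFDerivWithin ℝ i (u ε) (Ω : Set (Eu d)) x‖ ≤ C i * ρ ε x :=
    (Filter.eventually_all_finset _).2 fun i hi =>
      hC i (by have := Finset.mem_range.1 hi; omega)
  have A' : ∀ᶠ ε in toZero, ∀ i ∈ Finset.range (n + 1), ∀ x ∈ S,
      ‖iteratedFDerivWithin ℝ i (v ε) (Ω : Set (Eu d)) x‖ ≤ C' i * ρ' ε x :=
    (Filter.eventually_all_finset _).2 fun i hi =>
      hC' i (by have := Finset.mem_range.1 hi; omega)
  refine ⟨∑ i ∈ Finset.range (n + 1), (n.choose i : ℝ) * |C i| * C' (n - i), ?_⟩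
  filter_upwards [A, A'] with ε h1 h2 x hx
  have hx' : x ∈ (Ω : Set (Eu d)) := hS hx
  refine (norm_iteratedFDerivWithin_mul_le (hu ε) (hv ε) Ω.isOpen.uniqueDiffOn hx'
    (n := n) (by exact_mod_cast le_top)).trans ?_
  rw [Finset.sum_mul]
  refine Finset.sum_le_sum fun i hi => ?_
  have hi' := Finset.mem_range.1 hi
  have e1 : ‖iteratedFDerivWithin ℝ i (u ε) (Ω : Set (Eu d)) x‖ ≤ |C i| * ρ ε x :=
    (h1 i hi x hx).trans (mul_le_mul_of_nonneg_right (le_abs_self _) (h0 ε x hx))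
  have e2 := h2 (n - i) (Finset.mem_range.2 (by omega)) x hx
  calc (n.choose i : ℝ) * ‖iteratedFDerivWithin ℝ i (u ε) (Ω : Set (Eu d)) x‖
        * ‖iteratedFDerivWithin ℝ (n - i) (v ε) (Ω : Set (Eu d)) x‖
      ≤ (n.choose i : ℝ) * (|C i| * ρ ε x) * (C' (n - i) * ρ' ε x) := by
        refine mul_le_mul (mul_le_mul_of_nonneg_left e1 (by positivity)) e2 (norm_nonneg _) ?_
        exact mul_nonneg (by positivity) (mul_nonneg (abs_nonneg _) (h0 ε x hx))
    _ = _ := by ring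

theorem hasBound_const (c : ℂ) (n : ℕ) : HasBound Ω S n (fun _ _ => 1) (fun _ _ => c) := by
  rcases Nat.eq_zero_or_pos n with rfl | hn
  · refine ⟨‖c‖, Eventually.of_forall fun ε x _ => ?_⟩
    simp
  · refine ⟨0, Eventually.of_forall fun ε x _ => ?_⟩
    rw [iteratedFDerivWithin_const_of_ne hn.ne']
    simp

theorem IsSmoothNet.add (hu : IsSmoothNet Ω u) (hv : IsSmoothNet Ω v) : IsSmoothNet Ω (u + v) :=
  fun ε => (hu ε).add (hv ε)

theorem IsSmoothNet.mul (hu : IsSmoothNet Ω u) (hv : IsSmoothNet Ω v) : IsSmoothNet Ω (u * v) :=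
  fun ε => (hu ε).mul (hv ε)

theorem isSmoothNet_const (c : ℂ) : IsSmoothNet Ω (fun _ _ => c) := fun _ => contDiffOn_const

theorem IsModerate.uniform (hu : IsModerate Ω u) (hS : IsCompact S) (hSΩ : S ⊆ Ω) (n : ℕ) :
    ∃ N : ℕ, ∀ i, i ≤ n → HasBound Ω S i (fun ε _ => ((ε : ℝ) ^ N)⁻¹) u :=
  exists_uniform (P := fun i N => HasBound Ω S i (fun ε _ => ((ε : ℝ) ^ N)⁻¹) u)
    (fun _ _ _ hNM h => h.mono (fun ε _ _ => inv_nonneg.2 (pow_nonneg ε.2.1.le _))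
      (fun ε _ _ => idx_inv_pow_le ε hNM)) (fun i => hu.2 S hS hSΩ i) n

theorem IsTemperedModerate.uniform (hu : IsTemperedModerate Ω u) (n : ℕ) :
    ∃ N : ℕ, ∀ i, i ≤ n → HasBound Ω Ω i (fun ε x => ((ε : ℝ) ^ N)⁻¹ * (1 + ‖x‖) ^ N) u := by
  refine exists_uniform
    (P := fun i N => HasBound Ω Ω i (fun ε x => ((ε : ℝ) ^ N)⁻¹ * (1 + ‖x‖) ^ N) u)
    (fun _ N M hNM h => h.mono (fun ε x _ => ?_) (fun ε x _ => ?_)) (fun i => hu.2 i) n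
  · have := ε.2.1
    positivity
  · have h1 := idx_inv_pow_le ε hNM
    have h2 : (1 + ‖x‖) ^ N ≤ (1 + ‖x‖) ^ M :=
      pow_le_pow_right₀ (by linarith [norm_nonneg x]) hNM
    have := ε.2.1
    exact mul_le_mul h1 h2 (by positivity) (by positivity)

theorem IsTemperedNegligible.uniform (hu : IsTemperedNegligible Ω u) (n : ℕ) :
    ∃ N : ℕ, ∀ i, i ≤ n → ∀ p : ℕ,
      HasBound Ω Ω i (fun ε x => (ε : ℝ) ^ p * (1 + ‖x‖) ^ N) u := by
  refine exists_uniform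
    (P := fun i N => ∀ p : ℕ, HasBound Ω Ω i (fun ε x => (ε : ℝ) ^ p * (1 + ‖x‖) ^ N) u)
    (fun _ N M hNM h p => (h p).mono (fun ε x _ => ?_) (fun ε x _ => ?_)) (fun i => hu.2 i) n
  · have := ε.2.1
    positivity
  · have := ε.2.1
    exact mul_le_mul_of_nonneg_left
      (pow_le_pow_right₀ (by linarith [norm_nonneg x]) hNM) (by positivity)

theorem isModerate_const (c : ℂ) : IsModerate Ω (fun _ _ => c) :=
  ⟨isSmoothNet_const c, fun _ _ _ n => ⟨0, by simpa using hasBound_const c n⟩⟩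

theorem IsModerate.add (hu : IsModerate Ω u) (hv : IsModerate Ω v) : IsModerate Ω (u + v) := by
  refine ⟨hu.1.add hv.1, fun S hS hSΩ n => ?_⟩
  obtain ⟨N, hN⟩ := hu.2 S hS hSΩ n
  obtain ⟨M, hM⟩ := hv.2 S hS hSΩ n
  refine ⟨N + M, HasBound.add hSΩ hu.1 hv.1 (hN.mono ?_ ?_) (hM.mono ?_ ?_)⟩
  · exact fun ε _ _ => inv_nonneg.2 (pow_nonneg ε.2.1.le _)
  · exact fun ε _ _ => idx_inv_pow_le ε (by omega)
  · exact fun ε _ _ => inv_nonneg.2 (pow_nonneg ε.2.1.le _)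
  · exact fun ε _ _ => idx_inv_pow_le ε (by omega)

theorem IsModerate.mul (hu : IsModerate Ω u) (hv : IsModerate Ω v) : IsModerate Ω (u * v) := by
  refine ⟨hu.1.mul hv.1, fun S hS hSΩ n => ?_⟩
  obtain ⟨N, hN⟩ := hu.uniform hS hSΩ n
  obtain ⟨M, hM⟩ := hv.uniform hS hSΩ n
  refine ⟨N + M, ?_⟩
  have := HasBound.mul hSΩ hu.1 hv.1
    (fun ε _ _ => inv_nonneg.2 (pow_nonneg ε.2.1.le _)) hN hM
  simpa only [pow_add, mul_inv] using this

theorem isTemperedModerate_const (c : ℂ) : IsTemperedModerate Ω (fun _ _ => c) :=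
  ⟨isSmoothNet_const c, fun n => ⟨0, by simpa using hasBound_const c n⟩⟩

theorem IsTemperedModerate.add (hu : IsTemperedModerate Ω u) (hv : IsTemperedModerate Ω v) :
    IsTemperedModerate Ω (u + v) := by
  refine ⟨hu.1.add hv.1, fun n => ?_⟩
  obtain ⟨N, hN⟩ := hu.2 n
  obtain ⟨M, hM⟩ := hv.2 n
  have key : ∀ (A B : ℕ), A ≤ B → ∀ (ε : Idx) (x : Eu d),
      ((ε : ℝ) ^ A)⁻¹ * (1 + ‖x‖) ^ A ≤ ((ε : ℝ) ^ B)⁻¹ * (1 + ‖x‖) ^ B := by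
    intro A B hAB ε x
    have h1 := idx_inv_pow_le ε hAB
    have h2 : (1 + ‖x‖) ^ A ≤ (1 + ‖x‖) ^ B :=
      pow_le_pow_right₀ (by linarith [norm_nonneg x]) hAB
    have := ε.2.1
    exact mul_le_mul h1 h2 (by positivity) (by positivity)
  have pos : ∀ (A : ℕ) (ε : Idx) (x : Eu d), 0 ≤ ((ε : ℝ) ^ A)⁻¹ * (1 + ‖x‖) ^ A := by
    intro A ε x
    have := ε.2.1
    positivity
  exact ⟨N + M, HasBound.add subset_rfl hu.1 hv.1
    (hN.mono (fun ε x _ => pos _ ε x) fun ε x _ => key _ _ (by omega) ε x)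
    (hM.mono (fun ε x _ => pos _ ε x) fun ε x _ => key _ _ (by omega) ε x)⟩

theorem IsTemperedModerate.mul (hu : IsTemperedModerate Ω u) (hv : IsTemperedModerate Ω v) :
    IsTemperedModerate Ω (u * v) := by
  refine ⟨hu.1.mul hv.1, fun n => ?_⟩
  obtain ⟨N, hN⟩ := hu.uniform n
  obtain ⟨M, hM⟩ := hv.uniform n
  refine ⟨N + M, ?_⟩
  refine (HasBound.mul subset_rfl hu.1 hv.1 (fun ε x _ => ?_) hN hM).mono
    (fun ε x _ => ?_) (fun ε x _ => le_of_eq ?_)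
  · have := ε.2.1
    positivity
  · have := ε.2.1
    positivity
  · simp only [pow_add, mul_inv]
    ring

theorem isNegligible_zero : IsNegligible Ω 0 :=
  ⟨isSmoothNet_const 0, fun _ _ _ n m => ⟨0, Eventually.of_forall fun ε x _ => by
    simp [Pi.zero_def]⟩⟩

theorem IsNegligible.add (hu : IsNegligible Ω u) (hv : IsNegligible Ω v) :
    IsNegligible Ω (u + v) :=
  ⟨hu.1.add hv.1, fun S hS hSΩ n m =>
    HasBound.add hSΩ hu.1 hv.1 (hu.2 S hS hSΩ n m) (hv.2 S hS hSΩ n m)⟩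

theorem IsModerate.mul_negligible (hu : IsModerate Ω u) (hv : IsNegligible Ω v) :
    IsNegligible Ω (u * v) := by
  refine ⟨hu.1.mul hv.1, fun S hS hSΩ n m => ?_⟩
  obtain ⟨N, hN⟩ := hu.uniform hS hSΩ n
  refine (HasBound.mul hSΩ hu.1 hv.1 (fun ε x _ => ?_) hN
    (fun i _ => hv.2 S hS hSΩ i (N + m))).mono (fun ε x _ => ?_) (fun ε x _ => le_of_eq ?_)
  · exact inv_nonneg.2 (pow_nonneg ε.2.1.le _)
  · have := ε.2.1
    positivity
  · have := ε.2.1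
    rw [pow_add, inv_mul_cancel_left₀ (by positivity)]

theorem isTemperedNegligible_zero : IsTemperedNegligible Ω 0 :=
  ⟨isSmoothNet_const 0, fun n => ⟨0, fun p => ⟨0, Eventually.of_forall fun ε x _ => by
    simp [Pi.zero_def]⟩⟩⟩

theorem IsTemperedNegligible.add (hu : IsTemperedNegligible Ω u)
    (hv : IsTemperedNegligible Ω v) : IsTemperedNegligible Ω (u + v) := by
  refine ⟨hu.1.add hv.1, fun n => ?_⟩
  obtain ⟨N, hN⟩ := hu.2 n
  obtain ⟨M, hM⟩ := hv.2 n
  have key : ∀ (A B p : ℕ), A ≤ B → ∀ (ε : Idx) (x : Eu d),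
      (ε : ℝ) ^ p * (1 + ‖x‖) ^ A ≤ (ε : ℝ) ^ p * (1 + ‖x‖) ^ B := by
    intro A B p hAB ε x
    have := ε.2.1
    exact mul_le_mul_of_nonneg_left
      (pow_le_pow_right₀ (by linarith [norm_nonneg x]) hAB) (by positivity)
  have pos : ∀ (A p : ℕ) (ε : Idx) (x : Eu d), 0 ≤ (ε : ℝ) ^ p * (1 + ‖x‖) ^ A := by
    intro A p ε x
    have := ε.2.1
    positivity
  exact ⟨N + M, fun p => HasBound.add subset_rfl hu.1 hv.1
    ((hN p).mono (fun ε x _ => pos _ _ ε x) fun ε x _ => key _ _ _ (by omega) ε x)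
    ((hM p).mono (fun ε x _ => pos _ _ ε x) fun ε x _ => key _ _ _ (by omega) ε x)⟩

theorem IsTemperedModerate.mul_negligible (hu : IsTemperedModerate Ω u)
    (hv : IsTemperedNegligible Ω v) : IsTemperedNegligible Ω (u * v) := by
  refine ⟨hu.1.mul hv.1, fun n => ?_⟩
  obtain ⟨N, hN⟩ := hu.uniform n
  obtain ⟨M, hM⟩ := hv.uniform n
  refine ⟨N + M, fun p => ?_⟩
  refine (HasBound.mul subset_rfl hu.1 hv.1 (fun ε x _ => ?_) hN
    (fun i hi => hM i hi (N + p))).mono (fun ε x _ => ?_) (fun ε x _ => le_of_eq ?_)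
  · have := ε.2.1
    positivity
  · have := ε.2.1
    positivity
  · have := ε.2.1
    have hne : (ε : ℝ) ^ N ≠ 0 := by positivity
    simp only [pow_add]
    field_simp

/-- On a compact set the factor `1 + |x|` is bounded. -/
theorem exists_one_add_norm_le (hS : IsCompact S) : ∃ R : ℝ, 0 ≤ R ∧ ∀ x ∈ S, 1 + ‖x‖ ≤ R := by
  obtain ⟨R, hR⟩ := hS.isBounded.exists_norm_le
  exact ⟨1 + |R|, by positivity, fun x hx => by linarith [hR x hx, le_abs_self R]⟩

theorem IsTemperedModerate.isModerate (hu : IsTemperedModerate Ω u) : IsModerate Ω u := by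
  refine ⟨hu.1, fun S hS hSΩ n => ?_⟩
  obtain ⟨N, C, hC⟩ := hu.2 n
  obtain ⟨R, hR0, hR⟩ := exists_one_add_norm_le hS
  refine ⟨N, |C| * R ^ N, hC.mono fun ε hε x hx => (hε x (hSΩ hx)).trans ?_⟩
  have := ε.2.1
  have h1 : (1 + ‖x‖) ^ N ≤ R ^ N := pow_le_pow_left₀ (by positivity) (hR x hx) N
  calc C * (((ε : ℝ) ^ N)⁻¹ * (1 + ‖x‖) ^ N)
      ≤ |C| * (((ε : ℝ) ^ N)⁻¹ * (1 + ‖x‖) ^ N) :=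
        mul_le_mul_of_nonneg_right (le_abs_self C) (by positivity)
    _ ≤ |C| * (((ε : ℝ) ^ N)⁻¹ * R ^ N) := by gcongr
    _ = |C| * R ^ N * ((ε : ℝ) ^ N)⁻¹ := by ring

theorem IsTemperedNegligible.isNegligible (hu : IsTemperedNegligible Ω u) :
    IsNegligible Ω u := by
  refine ⟨hu.1, fun S hS hSΩ n m => ?_⟩
  obtain ⟨N, hN⟩ := hu.2 n
  obtain ⟨C, hC⟩ := hN m
  obtain ⟨R, hR0, hR⟩ := exists_one_add_norm_le hS
  refine ⟨|C| * R ^ N, hC.mono fun ε hε x hx => (hε x (hSΩ hx)).trans ?_⟩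
  have := ε.2.1
  have h1 : (1 + ‖x‖) ^ N ≤ R ^ N := pow_le_pow_left₀ (by positivity) (hR x hx) N
  calc C * ((ε : ℝ) ^ m * (1 + ‖x‖) ^ N)
      ≤ |C| * ((ε : ℝ) ^ m * (1 + ‖x‖) ^ N) :=
        mul_le_mul_of_nonneg_right (le_abs_self C) (by positivity)
    _ ≤ |C| * ((ε : ℝ) ^ m * R ^ N) := by gcongr
    _ = |C| * R ^ N * (ε : ℝ) ^ m := by ring

variable {d' : ℕ} {Ω' : Opens (Eu d')}

/-- A bound for the derivatives of `u_ε ∘ φ` on a compact set. -/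
theorem HasBound.comp {φ : Eu d' → Eu d} (hφ : ContDiffOn ℝ ∞ φ (Ω' : Set (Eu d')))
    (hmaps : Set.MapsTo φ (Ω' : Set (Eu d')) (Ω : Set (Eu d))) (hu : IsSmoothNet Ω u)
    {T : Set (Eu d')} (hT : IsCompact T) (hTΩ : T ⊆ Ω') {r : Idx → ℝ} (hr : ∀ ε, 0 ≤ r ε)
    (h : ∀ i, i ≤ n → HasBound Ω (φ '' T) i (fun ε _ => r ε) u) :
    HasBound Ω' T n (fun ε _ => r ε) (fun ε => u ε ∘ φ) := by
  have H : ∀ i, ∃ C : ℝ, i ≤ n → ∀ᶠ ε in toZero, ∀ x ∈ φ '' T,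
      ‖iteratedFDerivWithin ℝ i (u ε) (Ω : Set (Eu d)) x‖ ≤ C * r ε := by
    intro i
    by_cases hi : i ≤ n
    · obtain ⟨C, hC⟩ := h i hi
      exact ⟨C, fun _ => hC⟩
    · exact ⟨0, fun hi' => absurd hi' hi⟩
  choose C hC using H
  have A : ∀ᶠ ε in toZero, ∀ i ∈ Finset.range (n + 1), ∀ x ∈ φ '' T,
      ‖iteratedFDerivWithin ℝ i (u ε) (Ω : Set (Eu d)) x‖ ≤ C i * r ε :=
    (Filter.eventually_all_finset _).2 fun i hi =>
      hC i (by have := Finset.mem_range.1 hi; omega)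
  have B : ∀ i : ℕ, ∃ D : ℝ, ∀ x ∈ T,
      ‖iteratedFDerivWithin ℝ i φ (Ω' : Set (Eu d')) x‖ ≤ D := fun i =>
    hT.exists_bound_of_continuousOn
      ((hφ.continuousOn_iteratedFDerivWithin (m := i) (by exact_mod_cast le_top)
        Ω'.isOpen.uniqueDiffOn).mono hTΩ)
  choose D hD using B
  set C₀ : ℝ := ∑ i ∈ Finset.range (n + 1), |C i| with hC₀
  set D₀ : ℝ := 1 + ∑ i ∈ Finset.range (n + 1), |D i| with hD₀
  have hD1 : 1 ≤ D₀ := by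
    have : 0 ≤ ∑ i ∈ Finset.range (n + 1), |D i| := Finset.sum_nonneg fun _ _ => abs_nonneg _
    linarith
  refine ⟨n.factorial * C₀ * D₀ ^ n, A.mono fun ε hε x hx => ?_⟩
  have := norm_iteratedFDerivWithin_comp_le (n := n) (C := C₀ * r ε) (D := D₀) (hu ε) hφ
    (by exact_mod_cast le_top) Ω.isOpen.uniqueDiffOn Ω'.isOpen.uniqueDiffOn hmaps (hTΩ hx)
    (fun i hi => ?_) (fun i hi1 hi => ?_)
  · refine this.trans (le_of_eq ?_)
    ring
  · have hi' : i ∈ Finset.range (n + 1) := Finset.mem_range.2 (by omega)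
    refine (hε i hi' _ (Set.mem_image_of_mem φ hx)).trans
      (mul_le_mul_of_nonneg_right ((le_abs_self _).trans ?_) (hr ε))
    exact Finset.single_le_sum (f := fun i => |C i|) (fun _ _ => abs_nonneg _) hi'
  · have hi' : i ∈ Finset.range (n + 1) := Finset.mem_range.2 (by omega)
    have h1 : |D i| ≤ ∑ i ∈ Finset.range (n + 1), |D i| :=
      Finset.single_le_sum (f := fun i => |D i|) (fun _ _ => abs_nonneg _) hi'
    calc ‖iteratedFDerivWithin ℝ i φ (Ω' : Set (Eu d')) x‖ ≤ D i := hD i x hx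
      _ ≤ D₀ := by linarith [le_abs_self (D i)]
      _ ≤ D₀ ^ i := le_self_pow₀ hD1 (by omega)

theorem IsSmoothNet.comp {φ : Eu d' → Eu d} (hu : IsSmoothNet Ω u)
    (hφ : ContDiffOn ℝ ∞ φ (Ω' : Set (Eu d')))
    (hmaps : Set.MapsTo φ (Ω' : Set (Eu d')) (Ω : Set (Eu d))) :
    IsSmoothNet Ω' (fun ε => u ε ∘ φ) := fun ε => (hu ε).comp hφ hmaps

theorem IsModerate.comp {φ : Eu d' → Eu d} (hu : IsModerate Ω u)
    (hφ : ContDiffOn ℝ ∞ φ (Ω' : Set (Eu d')))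
    (hmaps : Set.MapsTo φ (Ω' : Set (Eu d')) (Ω : Set (Eu d))) :
    IsModerate Ω' (fun ε => u ε ∘ φ) := by
  refine ⟨hu.1.comp hφ hmaps, fun T hT hTΩ n => ?_⟩
  have hc : IsCompact (φ '' T) := hT.image_of_continuousOn (hφ.continuousOn.mono hTΩ)
  have hs : φ '' T ⊆ Ω := (Set.image_mono hTΩ).trans hmaps.image_subset
  obtain ⟨N, hN⟩ := hu.uniform hc hs n
  exact ⟨N, HasBound.comp hφ hmaps hu.1 hT hTΩ
    (fun ε => inv_nonneg.2 (pow_nonneg ε.2.1.le _)) hN⟩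

theorem IsNegligible.comp {φ : Eu d' → Eu d} (hu : IsNegligible Ω u)
    (hφ : ContDiffOn ℝ ∞ φ (Ω' : Set (Eu d')))
    (hmaps : Set.MapsTo φ (Ω' : Set (Eu d')) (Ω : Set (Eu d))) :
    IsNegligible Ω' (fun ε => u ε ∘ φ) := by
  refine ⟨hu.1.comp hφ hmaps, fun T hT hTΩ n m => ?_⟩
  have hc : IsCompact (φ '' T) := hT.image_of_continuousOn (hφ.continuousOn.mono hTΩ)
  have hs : φ '' T ⊆ Ω := (Set.image_mono hTΩ).trans hmaps.image_subset
  exact HasBound.comp hφ hmaps hu.1 hT hTΩ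
    (fun ε => pow_nonneg ε.2.1.le _) (fun i _ => hu.2 _ hc hs i m)

theorem isModerate_of_contDiffOn {f : Eu d → ℂ} (hf : ContDiffOn ℝ ∞ f (Ω : Set (Eu d))) :
    IsModerate Ω (fun _ => f) := by
  refine ⟨fun _ => hf, fun S hS hSΩ n => ?_⟩
  obtain ⟨C, hC⟩ := hS.exists_bound_of_continuousOn
    ((hf.continuousOn_iteratedFDerivWithin (m := n) (by exact_mod_cast le_top)
        Ω.isOpen.uniqueDiffOn).mono hSΩ)
  exact ⟨0, C, Eventually.of_forall fun ε x hx => by simpa using hC x hx⟩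

end Estimates

/-- The algebra `ℰ_M(Ω)` of moderate nets. -/
def moderate {d : ℕ} (Ω : Opens (Eu d)) : Subalgebra ℂ (Net d) where
  carrier := {u | IsModerate Ω u}
  mul_mem' hu hv := IsModerate.mul hu hv
  add_mem' hu hv := IsModerate.add hu hv
  algebraMap_mem' c := isModerate_const c

/-- The ideal `𝒩(Ω)` of negligible nets in `ℰ_M(Ω)`. -/
def negligible {d : ℕ} (Ω : Opens (Eu d)) : Ideal (moderate Ω) where
  carrier := {u | IsNegligible Ω (u : Net d)}
  zero_mem' := isNegligible_zero
  add_mem' hu hv := IsNegligible.add hu hv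
  smul_mem' a _ hu := IsModerate.mul_negligible a.2 hu

/-- The special Colombeau algebra `𝒢(Ω) = ℰ_M(Ω) / 𝒩(Ω)`. -/
abbrev G {d : ℕ} (Ω : Opens (Eu d)) : Type := moderate Ω ⧸ negligible Ω

/-- The algebra `ℰ_{M,τ}(Ω)` of tempered moderate nets. -/
def temperedModerate {d : ℕ} (Ω : Opens (Eu d)) : Subalgebra ℂ (Net d) where
  carrier := {u | IsTemperedModerate Ω u}
  mul_mem' hu hv := IsTemperedModerate.mul hu hv
  add_mem' hu hv := IsTemperedModerate.add hu hv
  algebraMap_mem' c := isTemperedModerate_const c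

/-- The ideal `𝒩_τ(Ω)` of tempered negligible nets in `ℰ_{M,τ}(Ω)`. -/
def temperedNegligible {d : ℕ} (Ω : Opens (Eu d)) : Ideal (temperedModerate Ω) where
  carrier := {u | IsTemperedNegligible Ω (u : Net d)}
  zero_mem' := isTemperedNegligible_zero
  add_mem' hu hv := IsTemperedNegligible.add hu hv
  smul_mem' a _ hu := IsTemperedModerate.mul_negligible a.2 hu

/-- The algebra `𝒢_τ(Ω) = ℰ_{M,τ}(Ω) / 𝒩_τ(Ω)` of tempered generalized functions. -/
abbrev Gτ {d : ℕ} (Ω : Opens (Eu d)) : Type := temperedModerate Ω ⧸ temperedNegligible Ω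

/-- The canonical map `K : 𝒢_τ(Ω) → 𝒢(Ω)`, `[(u_ε)] ↦ [(u_ε)]`. -/
def K {d : ℕ} (Ω : Opens (Eu d)) : Gτ Ω →ₐ[ℂ] G Ω :=
  Ideal.quotientMapₐ (negligible Ω)
    (Subalgebra.inclusion (S := temperedModerate Ω) (T := moderate Ω)
      fun _ hu => IsTemperedModerate.isModerate hu)
    fun _ hu => IsTemperedNegligible.isNegligible hu

/-- Composition with a smooth map, on moderate nets. -/
def netComp {d d' : ℕ} {Ω : Opens (Eu d)} {Ω' : Opens (Eu d')} (φ : Eu d' → Eu d)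
    (hφ : ContDiffOn ℝ ∞ φ (Ω' : Set (Eu d')))
    (hmaps : Set.MapsTo φ (Ω' : Set (Eu d')) (Ω : Set (Eu d))) : moderate Ω →ₐ[ℂ] moderate Ω' where
  toFun u := ⟨fun ε => (u : Net d) ε ∘ φ, IsModerate.comp u.2 hφ hmaps⟩
  map_one' := rfl
  map_mul' _ _ := rfl
  map_zero' := rfl
  map_add' _ _ := rfl
  commutes' _ := rfl

/-- The composition `u ∘ φ ∈ 𝒢(Ω')`, that is `[(u_ε ∘ φ)]`, of `u = [(u_ε)] ∈ 𝒢(Ω)` with a smooth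
map `φ : Ω' → Ω`. -/
def G.comp {d d' : ℕ} {Ω : Opens (Eu d)} {Ω' : Opens (Eu d')} (u : G Ω) (φ : Eu d' → Eu d)
    (hφ : ContDiffOn ℝ ∞ φ (Ω' : Set (Eu d')))
    (hmaps : Set.MapsTo φ (Ω' : Set (Eu d')) (Ω : Set (Eu d))) : G Ω' :=
  Ideal.quotientMapₐ (negligible Ω') (netComp φ hφ hmaps)
    (fun w hu => IsNegligible.comp (u := (w : Net d)) hu hφ hmaps) u

/-- The element `[(f)_ε]` of `𝒢(Ω)` given by a smooth function `f` on `Ω`. -/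
def ofSmooth {d : ℕ} (Ω : Opens (Eu d)) (f : Eu d → ℂ)
    (hf : ContDiffOn ℝ ∞ f (Ω : Set (Eu d))) : G Ω :=
  Ideal.Quotient.mk (negligible Ω) ⟨fun _ => f, isModerate_of_contDiffOn hf⟩

/-- `ℝ^d ∖ {0}` as an open set. -/
def punctured (d : ℕ) : Opens (Eu d) := ⟨{0}ᶜ, isOpen_compl_singleton⟩

/-- `Ω` is a cone: `λ x ∈ Ω` for all `x ∈ Ω` and `λ > 0`. -/
def IsCone {d : ℕ} (Ω : Opens (Eu d)) : Prop :=
  ∀ c : ℝ, 0 < c → Set.MapsTo (fun x : Eu d => c • x) (Ω : Set (Eu d)) (Ω : Set (Eu d))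

theorem isCone_univ (d : ℕ) : IsCone (⊤ : Opens (Eu d)) := fun _ _ _ _ => trivial

theorem isCone_punctured (d : ℕ) : IsCone (punctured d) := fun _ hc _ hx =>
  smul_ne_zero hc.ne' hx

theorem contDiffOn_smul_const {d : ℕ} (Ω : Opens (Eu d)) (c : ℝ) :
    ContDiffOn ℝ ∞ (fun x : Eu d => c • x) (Ω : Set (Eu d)) :=
  (contDiff_id.const_smul c).contDiffOn

/-- `u ∈ 𝒢(Ω)` is homogeneous of degree `α`: for every real `c > 0` the equality
`u(c x) = c^α u(x)` holds in `𝒢(Ω)`. -/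
def G.IsHomogeneous {d : ℕ} {Ω : Opens (Eu d)} (hΩ : IsCone Ω) (u : G Ω) (α : ℝ) : Prop :=
  ∀ (c : ℝ) (hc : 0 < c),
    u.comp (fun x => c • x) (contDiffOn_smul_const Ω c) (hΩ c hc) = ((c ^ α : ℝ) : ℂ) • u

theorem contDiffOn_normalize (d : ℕ) :
    ContDiffOn ℝ ∞ (fun x : Eu d => ‖x‖⁻¹ • x) (punctured d : Set (Eu d)) := by
  intro x hx
  have hx' : x ≠ 0 := hx
  exact (((contDiffAt_norm ℝ hx').inv (norm_ne_zero_iff.2 hx')).smul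
    contDiffAt_id).contDiffWithinAt

theorem mapsTo_normalize (d : ℕ) :
    Set.MapsTo (fun x : Eu d => ‖x‖⁻¹ • x) (punctured d : Set (Eu d))
      (punctured d : Set (Eu d)) := fun x hx => by
  have hx' : x ≠ 0 := hx
  exact smul_ne_zero (inv_ne_zero (norm_ne_zero_iff.2 hx')) hx'

theorem contDiffOn_normPow (d : ℕ) (α : ℝ) :
    ContDiffOn ℝ ∞ (fun x : Eu d => ((‖x‖ ^ α : ℝ) : ℂ)) (punctured d : Set (Eu d)) := by
  intro x hx
  have hx' : x ≠ 0 := hx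
  exact (Complex.ofRealCLM.contDiff.contDiffAt.comp x
    ((contDiffAt_norm ℝ hx').rpow_const_of_ne (norm_ne_zero_iff.2 hx'))).contDiffWithinAt

/-- `u(x/|x|) ∈ 𝒢(ℝ^d ∖ {0})`. -/
def G.radialProj {d : ℕ} (u : G (punctured d)) : G (punctured d) :=
  u.comp (fun x => ‖x‖⁻¹ • x) (contDiffOn_normalize d) (mapsTo_normalize d)

/-- `|x|^α ∈ 𝒢(ℝ^d ∖ {0})`. -/
def normPow (d : ℕ) (α : ℝ) : G (punctured d) :=
  ofSmooth (punctured d) (fun x => ((‖x‖ ^ α : ℝ) : ℂ)) (contDiffOn_normPow d α)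

end Colombeau

end

namespace Colombeau

/-! Homogeneity in the quotient gives, for each fixed dilation factor `c`, a negligible defect
`u_ε(c x) - c^α u_ε(x)`, but with no uniformity in `c`. Both claims rest on recovering it. For a
fixed order `m` and a compact set, the sets of `s = log c` on which the estimate holds with a given
constant and a given threshold for `ε` are closed and cover `ℝ`, so by Baire one of them has
interior. The multiplicative cocycle relation `homDefect_mul` moves this interval to any point, and
compactness gives uniformity on compact sets of `s` (`uniform_homDefect`).

One may then let `c` depend on `x`. The choice `c = 1/|x|` yields the order-zero estimates for `u -
u(x/|x|)|x|^α`, and for moderate nets these already imply negligibility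
(`IsModerate.isNegligible_of_zero`). This is the first claim.

For the second, `h = u(x/|x|)|x|^α` is exactly homogeneous, so its derivatives grow polynomially
away from the origin, with constants read off from the unit sphere. If `χ` vanishes near `0` and is
`1` far out, then `u - χ(u - h)` differs from `u` by a negligible net on all of `ℝ^d` and equals `h`
far out, hence is a tempered representative. -/

/-! ### Uniformity of the homogeneity defect in the dilation factor -/

theorem eventually_toZero_iff {P : Idx → Prop} :
    (∀ᶠ ε in toZero, P ε) ↔ ∃ n : ℕ, ∀ ε : Idx, (ε : ℝ) ≤ 1 / ((n : ℝ) + 1) → P ε := by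
  have hb : toZero.HasBasis (fun r : ℝ => 0 < r) fun r => {ε : Idx | (ε : ℝ) ∈ Metric.ball 0 r} :=
    Metric.nhds_basis_ball.comap _
  rw [hb.eventually_iff]
  constructor
  · rintro ⟨r, hr, h⟩
    obtain ⟨n, hn⟩ := exists_nat_one_div_lt hr
    refine ⟨n, fun ε hε => h ?_⟩
    simp only [Set.mem_ofPred_eq, Metric.mem_ball, dist_zero_right, Real.norm_eq_abs,
      abs_of_pos ε.2.1]
    exact hε.trans_lt hn
  · rintro ⟨n, h⟩
    refine ⟨1 / ((n : ℝ) + 1), by positivity, fun ε hε => h ε ?_⟩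
    simp only [Set.mem_ofPred_eq, Metric.mem_ball, dist_zero_right, Real.norm_eq_abs,
      abs_of_pos ε.2.1] at hε
    exact hε.le

/-- The defect of homogeneity `u_ε(c x) - c^α u_ε(x)`, as a net. -/
noncomputable def homDefect {d : ℕ} (α c : ℝ) (u : Net d) : Net d :=
  fun ε x => u ε (c • x) - ((c ^ α : ℝ) : ℂ) * u ε x

variable {d : ℕ} {Ω : Opens (Eu d)} {u : Net d} {α : ℝ}

theorem HasBound.zero_iff {S : Set (Eu d)} {ρ : Idx → Eu d → ℝ} :
    HasBound Ω S 0 ρ u ↔ ∃ C : ℝ, ∀ᶠ ε in toZero, ∀ x ∈ S, ‖u ε x‖ ≤ C * ρ ε x := by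
  simp only [HasBound, norm_iteratedFDerivWithin_zero]

/-- Baire category in the variable `s = log c`. Locating `t` in `(0, 1)` gives a range for it known
before `L` is chosen, which the translation argument in `exists_locally_uniform_homDefect` needs. -/
theorem exists_uniform_homDefect (hΩ : IsCone Ω) (hu : IsSmoothNet Ω u) {L : Set (Eu d)}
    (hLΩ : L ⊆ Ω) (m : ℕ)
    (h : ∀ c : ℝ, 0 < c → HasBound Ω L 0 (fun ε _ => (ε : ℝ) ^ m) (homDefect α c u)) :
    ∃ t ∈ Set.Ioo (0 : ℝ) 1, ∃ V ∈ 𝓝 t, ∃ C : ℝ, ∀ᶠ ε in toZero, ∀ s ∈ V, ∀ x ∈ L,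
      ‖homDefect α (Real.exp s) u ε x‖ ≤ C * (ε : ℝ) ^ m := by
  -- One integer `n` serves both as the constant and as the threshold `1/(n+1)` for `ε`, which keeps
  -- the cover countable.
  let A : ℕ → Set ℝ := fun n => {s | ∀ ε : Idx, (ε : ℝ) ≤ 1 / ((n : ℝ) + 1) → ∀ x ∈ L,
    ‖homDefect α (Real.exp s) u ε x‖ ≤ n * (ε : ℝ) ^ m}
  have hA : ∀ n, IsClosed (A n) := by
    intro n
    simp only [A, Set.ofPred_forall]
    refine isClosed_iInter fun ε => isClosed_iInter fun _ => isClosed_iInter fun x =>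
      isClosed_iInter fun hx => isClosed_le ?_ continuous_const
    have h1 : Continuous fun s : ℝ => u ε (Real.exp s • x) :=
      (hu ε).continuousOn.comp_continuous (by fun_prop)
        (fun s => hΩ _ (Real.exp_pos s) (hLΩ hx))
    have h2 : Continuous fun s : ℝ => ((Real.exp s ^ α : ℝ) : ℂ) :=
      Complex.continuous_ofReal.comp
        (Real.continuous_exp.rpow_const fun s => Or.inl (Real.exp_pos s).ne')
    exact (h1.sub (h2.mul continuous_const)).norm
  have hU : ⋃ n, A n = Set.univ := by
    refine Set.eq_univ_of_forall fun s => Set.mem_iUnion.2 ?_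
    obtain ⟨C, hC⟩ := HasBound.zero_iff.1 (h _ (Real.exp_pos s))
    obtain ⟨n, hn⟩ := eventually_toZero_iff.1 hC
    obtain ⟨k, hk⟩ := exists_nat_ge C
    refine ⟨max n k, fun ε hε x hx => (hn ε (hε.trans ?_) x hx).trans ?_⟩
    · have : (n : ℝ) ≤ (max n k : ℕ) := by exact_mod_cast le_max_left n k
      exact one_div_le_one_div_of_le (by positivity) (by linarith)
    · have : (k : ℝ) ≤ (max n k : ℕ) := by exact_mod_cast le_max_right n k
      exact mul_le_mul_of_nonneg_right (hk.trans this) (pow_nonneg ε.2.1.le _)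
  obtain ⟨t, ht, htA⟩ := (dense_iUnion_interior_of_closed hA hU).exists_mem_open
    (isOpen_Ioo (a := (0 : ℝ)) (b := 1)) ⟨1 / 2, by norm_num, by norm_num⟩
  obtain ⟨n, hn⟩ := Set.mem_iUnion.1 ht
  exact ⟨t, htA, interior (A n), isOpen_interior.mem_nhds hn, n,
    eventually_toZero_iff.2 ⟨n, fun ε hε s hs x hx => interior_subset hs ε hε x hx⟩⟩

theorem homDefect_mul {a b : ℝ} (ha : 0 ≤ a) (hb : 0 ≤ b) (ε : Idx) (x : Eu d) :
    homDefect α (a * b) u ε x =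
      homDefect α a u ε (b • x) + ((a ^ α : ℝ) : ℂ) * homDefect α b u ε x := by
  simp only [homDefect, Real.mul_rpow ha hb, mul_smul]
  push_cast
  ring

/-- Since `e^s = e^(s - (t₀ - t)) e^(t₀ - t)`, the cocycle relation splits the defect into one at a
parameter near the Baire point `t`, and one at the single factor `e^(t₀ - t)`, where no uniformity
is required. -/
theorem exists_locally_uniform_homDefect (hΩ : IsCone Ω) (hu : IsSmoothNet Ω u) (m : ℕ)
    (h : ∀ c : ℝ, 0 < c → ∀ L : Set (Eu d), IsCompact L → L ⊆ Ω →
      HasBound Ω L 0 (fun ε _ => (ε : ℝ) ^ m) (homDefect α c u))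
    {L : Set (Eu d)} (hL : IsCompact L) (hLΩ : L ⊆ Ω) (t₀ : ℝ) :
    ∃ V ∈ 𝓝 t₀, ∃ C : ℝ, ∀ᶠ ε in toZero, ∀ s ∈ V, ∀ x ∈ L,
      ‖homDefect α (Real.exp s) u ε x‖ ≤ C * (ε : ℝ) ^ m := by
  -- The point `t` depends on the compact set to which Baire is applied. As `t ∈ (0, 1)`, `L'`
  -- contains `e^(t₀ - t) • L` whatever `t` turns out to be.
  set L' : Set (Eu d) := (fun p : ℝ × Eu d => Real.exp p.1 • p.2) '' (Set.Icc (t₀ - 1) t₀ ×ˢ L)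
  have hL'c : IsCompact L' := (isCompact_Icc.prod hL).image (by fun_prop)
  have hL'Ω : L' ⊆ Ω := by
    rintro _ ⟨p, hp, rfl⟩
    exact hΩ _ (Real.exp_pos _) (hLΩ hp.2)
  obtain ⟨t, ht, V, hV, C, hC⟩ :=
    exists_uniform_homDefect hΩ hu hL'Ω m fun c hc => h c hc L' hL'c hL'Ω
  obtain ⟨C', hC'⟩ := HasBound.zero_iff.1 (h (Real.exp (t₀ - t)) (Real.exp_pos _) L hL hLΩ)
  -- Bounds `(e^r)^α` for `|r| ≤ t + 1`, the range imposed on `r = s - (t₀ - t)` below.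
  set D : ℝ := Real.exp ((t + 1) * |α|) with hD
  have hcont : Tendsto (fun s : ℝ => s - (t₀ - t)) (𝓝 t₀) (𝓝 t) := by
    have : Continuous fun s : ℝ => s - (t₀ - t) := by fun_prop
    simpa using this.tendsto t₀
  refine ⟨{s | s - (t₀ - t) ∈ V ∧ |s - (t₀ - t)| ≤ t + 1},
    (hcont.eventually_mem hV).and (hcont.eventually_mem (s := {r : ℝ | |r| ≤ t + 1}) ?_),
    C + D * |C'|, ?_⟩
  · refine mem_of_superset (Icc_mem_nhds (sub_one_lt t) (lt_add_one t)) ?_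
    intro r hr
    exact abs_le.2 ⟨by linarith [hr.1, ht.1], hr.2⟩
  filter_upwards [hC, hC'] with ε h1 h2 s hs x hx
  have e : Real.exp s = Real.exp (s - (t₀ - t)) * Real.exp (t₀ - t) := by
    rw [← Real.exp_add]; congr 1; ring
  have hε := pow_nonneg ε.2.1.le m
  rw [e, homDefect_mul (Real.exp_pos _).le (Real.exp_pos _).le]
  have hmem : Real.exp (t₀ - t) • x ∈ L' :=
    ⟨(t₀ - t, x), ⟨⟨by linarith [ht.2], by linarith [ht.1]⟩, hx⟩, rfl⟩
  refine (norm_add_le _ _).trans ?_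
  rw [add_mul]
  refine add_le_add (h1 _ hs.1 _ hmem) ?_
  rw [norm_mul, Complex.norm_real, Real.norm_eq_abs, abs_of_nonneg (by positivity), mul_assoc]
  have h3 : Real.exp (s - (t₀ - t)) ^ α ≤ D := by
    rw [← Real.exp_mul, hD]
    refine Real.exp_le_exp.2 ((le_abs_self _).trans ?_)
    rw [abs_mul]
    exact mul_le_mul_of_nonneg_right hs.2 (abs_nonneg _)
  exact mul_le_mul h3 ((h2 x hx).trans (mul_le_mul_of_nonneg_right (le_abs_self _) hε))
    (norm_nonneg _) (Real.exp_pos _).le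

theorem uniform_homDefect (hΩ : IsCone Ω) (hu : IsSmoothNet Ω u) (m : ℕ)
    (h : ∀ c : ℝ, 0 < c → ∀ L : Set (Eu d), IsCompact L → L ⊆ Ω →
      HasBound Ω L 0 (fun ε _ => (ε : ℝ) ^ m) (homDefect α c u))
    {L : Set (Eu d)} (hL : IsCompact L) (hLΩ : L ⊆ Ω) {T : Set ℝ} (hT : IsCompact T) :
    ∃ C : ℝ, ∀ᶠ ε in toZero, ∀ s ∈ T, ∀ x ∈ L,
      ‖homDefect α (Real.exp s) u ε x‖ ≤ C * (ε : ℝ) ^ m := by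
  refine hT.induction_on (p := fun T => ∃ C : ℝ, ∀ᶠ ε in toZero, ∀ s ∈ T, ∀ x ∈ L,
      ‖homDefect α (Real.exp s) u ε x‖ ≤ C * (ε : ℝ) ^ m) ⟨0, by simp⟩ ?_ ?_ ?_
  · rintro s t hst ⟨C, hC⟩
    exact ⟨C, hC.mono fun ε hε r hr => hε r (hst hr)⟩
  · rintro s t ⟨C, hC⟩ ⟨C', hC'⟩
    refine ⟨max C C', ?_⟩
    filter_upwards [hC, hC'] with ε h1 h2 r hr x hx
    have hε := pow_nonneg ε.2.1.le m
    rcases hr with hr | hr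
    · exact (h1 r hr x hx).trans (mul_le_mul_of_nonneg_right (le_max_left _ _) hε)
    · exact (h2 r hr x hx).trans (mul_le_mul_of_nonneg_right (le_max_right _ _) hε)
  · intro t _
    obtain ⟨V, hV, hC⟩ := exists_locally_uniform_homDefect hΩ hu m h hL hLΩ t
    exact ⟨V, mem_nhdsWithin_of_mem_nhds hV, hC⟩

/-! ### Negligibility from order-zero estimates -/

/-- A Landau–Kolmogorov type inequality. Linearising the `n`-th derivative at `x` over a step `v` of
length `h` leaves an error at most `B h * h`, while the increment itself is at most `2A`; division
by `h` gives the bound. -/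
theorem norm_iteratedFDerivWithin_succ_le_of_le {E F : Type*} [NormedAddCommGroup E]
    [NormedSpace ℝ E] [NormedAddCommGroup F] [NormedSpace ℝ F] {s : Set E} (hs : IsOpen s)
    {f : E → F} (hf : ContDiffOn ℝ ∞ f s) {n : ℕ} {x : E} {h A B : ℝ} (hh : 0 < h)
    (hball : Metric.closedBall x h ⊆ s)
    (hA : ∀ y ∈ Metric.closedBall x h, ‖iteratedFDerivWithin ℝ n f s y‖ ≤ A)
    (hB : ∀ y ∈ Metric.closedBall x h, ‖iteratedFDerivWithin ℝ (n + 2) f s y‖ ≤ B) :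
    ‖iteratedFDerivWithin ℝ (n + 1) f s x‖ ≤ 2 * A / h + B * h := by
  have hxm : x ∈ Metric.closedBall x h := Metric.mem_closedBall_self hh.le
  have hA0 : 0 ≤ A := (norm_nonneg _).trans (hA x hxm)
  have hB0 : 0 ≤ B := (norm_nonneg _).trans (hB x hxm)
  have hconv := convex_closedBall x h
  have hdiff : ∀ k : ℕ, ∀ y ∈ s, HasFDerivAt (iteratedFDerivWithin ℝ k f s)
      (fderivWithin ℝ (iteratedFDerivWithin ℝ k f s) s y) y := fun k y hy =>
    (((hf.differentiableOn_iteratedFDerivWithin (m := k) (by exact_mod_cast ENat.natCast_lt_top k)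
      hs.uniqueDiffOn) y hy).hasFDerivWithinAt).hasFDerivAt (hs.mem_nhds hy)
  set f' := fderivWithin ℝ (iteratedFDerivWithin ℝ n f s) s with hf'
  have hlip : ∀ y ∈ Metric.closedBall x h, ‖f' y - f' x‖ ≤ B * h := by
    intro y hy
    -- The derivative of the `n`-th derivative and the derivative of order `n + 1` correspond under
    -- a linear isometry, so their increments have equal norm.
    have e : ‖f' y - f' x‖ = ‖iteratedFDerivWithin ℝ (n + 1) f s y
        - iteratedFDerivWithin ℝ (n + 1) f s x‖ := by
      rw [iteratedFDerivWithin_succ_eq_comp_left, ← dist_eq_norm]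
      exact (dist_eq_norm (f' y) (f' x)).symm.trans (LinearIsometryEquiv.dist_map _ _ _).symm
    rw [e]
    refine (hconv.norm_image_sub_le_of_norm_hasFDerivWithin_le (C := B)
      (fun z hz => (hdiff (n + 1) z (hball hz)).hasFDerivWithinAt) (fun z hz => ?_) hxm hy).trans ?_
    · rw [norm_fderivWithin_iteratedFDerivWithin]
      exact hB z hz
    · exact mul_le_mul_of_nonneg_left (by simpa [dist_eq_norm] using hy) hB0
  have key : ∀ v : E, ‖v‖ = h → ‖f' x v‖ ≤ (2 * A / h + B * h) * ‖v‖ := by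
    intro v hv
    have hxv : x + v ∈ Metric.closedBall x h := by simp [hv]
    have h1 := hconv.norm_image_sub_le_of_norm_hasFDerivWithin_le' (C := B * h)
      (f := iteratedFDerivWithin ℝ n f s) (f' := f') (φ := f' x)
      (fun z hz => (hdiff n z (hball hz)).hasFDerivWithinAt) hlip hxm hxv
    rw [add_sub_cancel_left] at h1
    have h2 := hA _ hxm
    have h3 := hA _ hxv
    have h4 : ‖f' x v‖ ≤ A + A + B * h * ‖v‖ := by
      have : f' x v = iteratedFDerivWithin ℝ n f s (x + v) - iteratedFDerivWithin ℝ n f s x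
          - (iteratedFDerivWithin ℝ n f s (x + v) - iteratedFDerivWithin ℝ n f s x - f' x v) := by
        abel
      rw [this]
      refine (norm_sub_le _ _).trans (add_le_add ((norm_sub_le _ _).trans (add_le_add h3 h2)) h1)
    refine h4.trans (le_of_eq ?_)
    rw [hv]
    field_simp
    ring
  rw [← norm_fderivWithin_iteratedFDerivWithin]
  refine ContinuousLinearMap.opNorm_le_bound _ (by positivity) fun v => ?_
  rcases eq_or_ne v 0 with rfl | hv
  · simp
  have hv' : 0 < ‖v‖ := norm_pos_iff.2 hv
  -- By linearity it suffices to test vectors of length exactly `h`, so `v` is rescaled to that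
  -- length.
  have h5 := key ((h / ‖v‖) • v) (by
    rw [norm_smul, Real.norm_eq_abs, abs_of_pos (by positivity)]
    field_simp)
  rw [map_smul, norm_smul, norm_smul] at h5
  have h6 : 0 < ‖h / ‖v‖‖ := by rw [norm_pos_iff]; positivity
  exact le_of_mul_le_mul_left (by linarith) h6

/-- A moderate net satisfying the negligibility estimates of order zero is negligible. -/
theorem IsModerate.isNegligible_of_zero (hu : IsModerate Ω u)
    (h : ∀ S : Set (Eu d), IsCompact S → S ⊆ Ω → ∀ m : ℕ,
      HasBound Ω S 0 (fun ε _ => (ε : ℝ) ^ m) u) : IsNegligible Ω u := by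
  refine ⟨hu.1, fun S hS hSΩ n => ?_⟩
  induction n generalizing S with
  | zero => exact h S hS hSΩ
  | succ n ih =>
    intro m
    -- Thickening leaves room for small balls around the points of `S`; this is why the induction
    -- runs over all compact sets at once.
    obtain ⟨δ, hδ, hδΩ⟩ := hS.exists_cthickening_subset_open Ω.isOpen hSΩ
    have hS' : IsCompact (Metric.cthickening δ S) := hS.cthickening
    obtain ⟨N, B, hB⟩ := hu.2 _ hS' hδΩ (n + 2)
    -- With step size `δ ε^(N+m)`, order `N + 2m` for the `n`-th derivative and order `-N` for the
    -- `(n+2)`-nd make both terms of the inequality of order `ε^m`.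
    obtain ⟨A, hA⟩ := ih _ hS' hδΩ (N + 2 * m)
    refine ⟨2 * A / δ + B * δ, ?_⟩
    filter_upwards [hA, hB] with ε hAε hBε x hx
    have hε := ε.2.1
    have hle : δ * (ε : ℝ) ^ (N + m) ≤ δ :=
      mul_le_of_le_one_right hδ.le (pow_le_one₀ hε.le ε.2.2)
    have hsub : Metric.closedBall x (δ * (ε : ℝ) ^ (N + m)) ⊆ Metric.cthickening δ S :=
      (Metric.closedBall_subset_closedBall hle).trans (Metric.closedBall_subset_cthickening hx δ)
    refine (norm_iteratedFDerivWithin_succ_le_of_le Ω.isOpen (hu.1 ε) (by positivity)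
      (hsub.trans hδΩ) (fun y hy => hAε y (hsub hy)) (fun y hy => hBε y (hsub hy))).trans
      (le_of_eq ?_)
    simp only [pow_add, two_mul]
    field_simp

/-! ### The radial homogeneous net and the first claim -/

variable {Ω' : Opens (Eu d)}

theorem iteratedFDerivWithin_opens_eq {x : Eu d} (hx : x ∈ Ω) (hx' : x ∈ Ω') (n : ℕ)
    (f : Eu d → ℂ) : iteratedFDerivWithin ℝ n f (Ω : Set (Eu d)) x =
      iteratedFDerivWithin ℝ n f (Ω' : Set (Eu d)) x := by
  rw [iteratedFDerivWithin_of_isOpen n Ω.isOpen hx, iteratedFDerivWithin_of_isOpen n Ω'.isOpen hx']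

theorem HasBound.congr_opens {S : Set (Eu d)} {n : ℕ} {ρ : Idx → Eu d → ℝ}
    (h : HasBound Ω S n ρ u) (hS : S ⊆ Ω) (hS' : S ⊆ Ω') : HasBound Ω' S n ρ u := by
  obtain ⟨C, hC⟩ := h
  refine ⟨C, hC.mono fun ε hε x hx => ?_⟩
  rw [iteratedFDerivWithin_opens_eq (hS' hx) (hS hx)]
  exact hε x hx

theorem IsModerate.restrict (hu : IsModerate Ω u) (h : Ω' ≤ Ω) : IsModerate Ω' u :=
  ⟨fun ε => (hu.1 ε).mono h, fun S hS hSΩ n =>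
    (hu.2 S hS (hSΩ.trans h) n).imp fun _ hN => hN.congr_opens (hSΩ.trans h) hSΩ⟩

theorem IsNegligible.restrict (hu : IsNegligible Ω u) (h : Ω' ≤ Ω) : IsNegligible Ω' u :=
  ⟨fun ε => (hu.1 ε).mono h, fun S hS hSΩ n m =>
    (hu.2 S hS (hSΩ.trans h) n m).congr_opens (hSΩ.trans h) hSΩ⟩

theorem IsNegligible.isModerate (hu : IsNegligible Ω u) : IsModerate Ω u :=
  ⟨hu.1, fun S hS hSΩ n => ⟨0, by simpa using hu.2 S hS hSΩ n 0⟩⟩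

/-- The net `u_ε(x/|x|) |x|^α`. -/
noncomputable def homExtension (α : ℝ) (u : Net d) : Net d :=
  fun ε x => u ε (‖x‖⁻¹ • x) * ((‖x‖ ^ α : ℝ) : ℂ)

theorem IsModerate.homExtension (hu : IsModerate (punctured d) u) :
    IsModerate (punctured d) (homExtension α u) :=
  (hu.comp (contDiffOn_normalize d) (mapsTo_normalize d)).mul
    (isModerate_of_contDiffOn (contDiffOn_normPow d α))

theorem IsModerate.sub (hu : IsModerate Ω u) {v : Net d} (hv : IsModerate Ω v) :
    IsModerate Ω (u - v) := (moderate Ω).sub_mem hu hv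

/-- Multiplying the defect at `c = 1/|x|` by `|x|^α` gives, up to sign, the difference in question.
As `x` runs through a compact set avoiding `0`, `-log |x|` stays in a compact set, so the uniform
estimate applies. -/
theorem isNegligible_sub_homExtension (hu : IsModerate (punctured d) u)
    (h : ∀ c : ℝ, 0 < c → IsNegligible (punctured d) (homDefect α c u)) :
    IsNegligible (punctured d) (u - homExtension α u) := by
  refine (hu.sub hu.homExtension).isNegligible_of_zero fun S hS hSΩ m => ?_
  have hne : ∀ x ∈ S, ‖x‖ ≠ 0 := fun x hx => norm_ne_zero_iff.2 (hSΩ hx)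
  have hT : IsCompact ((fun x : Eu d => -Real.log ‖x‖) '' S) :=
    hS.image_of_continuousOn (continuous_norm.continuousOn.log hne).neg
  obtain ⟨C, hC⟩ := uniform_homDefect (isCone_punctured d) hu.1 m
    (fun c hc L hL hLΩ => (h c hc).2 L hL hLΩ 0 m) hS hSΩ hT
  obtain ⟨D, hD⟩ := hS.exists_bound_of_continuousOn
    (continuous_norm.continuousOn.rpow_const (p := α) fun x hx => Or.inl (hne x hx))
  refine HasBound.zero_iff.2 ⟨D * C, hC.mono fun ε hε x hx => ?_⟩
  have hx0 : 0 < ‖x‖ := (norm_nonneg x).lt_of_ne (hne x hx).symm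
  have h1 := hε _ ⟨x, hx, rfl⟩ x hx
  rw [Real.exp_neg, Real.exp_log hx0] at h1
  have h2 : (u - homExtension α u) ε x =
      -(((‖x‖ ^ α : ℝ) : ℂ) * homDefect α ‖x‖⁻¹ u ε x) := by
    have h3 : ((‖x‖ ^ α : ℝ) : ℂ) * ((‖x‖⁻¹ ^ α : ℝ) : ℂ) = 1 := by
      rw [← Complex.ofReal_mul, ← Real.mul_rpow hx0.le (inv_nonneg.2 hx0.le),
        mul_inv_cancel₀ hx0.ne', Real.one_rpow, Complex.ofReal_one]
    simp only [Pi.sub_apply, homExtension, homDefect]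
    linear_combination (-u ε x) * h3
  rw [h2, norm_neg, norm_mul, Complex.norm_real, mul_assoc]
  exact mul_le_mul (hD x hx) h1 (norm_nonneg _) ((norm_nonneg _).trans (hD x hx))

theorem homExtension_smul {c : ℝ} (hc : 0 < c) (ε : Idx) (x : Eu d) :
    homExtension α u ε (c • x) = ((c ^ α : ℝ) : ℂ) * homExtension α u ε x := by
  have h : ‖c • x‖⁻¹ • c • x = ‖x‖⁻¹ • x := by
    rw [norm_smul, Real.norm_eq_abs, abs_of_pos hc, smul_smul, mul_inv, mul_right_comm,
      inv_mul_cancel₀ hc.ne', one_mul]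
  simp only [homExtension]
  rw [h, norm_smul, Real.norm_eq_abs, abs_of_pos hc, Real.mul_rpow hc.le (norm_nonneg x)]
  push_cast
  ring

/-! ### Polynomial growth of homogeneous nets away from the origin -/

/-- The derivatives of order `n` of a function that is positively homogeneous of degree `α` are
positively homogeneous of degree `α - n`. -/
theorem norm_iteratedFDeriv_smul_of_homogeneous {E : Type*} [NormedAddCommGroup E]
    [NormedSpace ℝ E] {f : E → ℂ} {c a : ℝ} (hc : 0 < c) (ha : 0 ≤ a)
    (hf : ∀ x, f (c • x) = (a : ℂ) * f x) {n : ℕ} {x : E} (hfx : ContDiffAt ℝ n f x) :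
    ‖iteratedFDeriv ℝ n f (c • x)‖ * c ^ n = a * ‖iteratedFDeriv ℝ n f x‖ := by
  let g : E ≃L[ℝ] E := ContinuousLinearEquiv.smulLeft (Units.mk0 c hc.ne')
  have hg : ∀ x, g x = c • x := fun x => rfl
  -- The `n`-th derivative of `x ↦ f (c • x)` is computed in two ways: by the chain rule here, by
  -- homogeneity in `h2`.
  have h1 : iteratedFDeriv ℝ n (fun x => f (c • x)) x = c ^ n • iteratedFDeriv ℝ n f (c • x) := by
    have := g.iteratedFDerivWithin_comp_right f uniqueDiffOn_univ (x := x) trivial n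
    simp only [Set.preimage_univ, iteratedFDerivWithin_univ] at this
    ext v
    refine (DFunLike.congr_fun this v).trans ?_
    simp [hg, ContinuousMultilinearMap.map_smul_univ]
  have h2 : iteratedFDeriv ℝ n (fun x => f (c • x)) x = a • iteratedFDeriv ℝ n f x := by
    rw [← iteratedFDeriv_const_smul_apply hfx]
    congr 1
    ext y
    simp [hf]
  have h3 := congrArg norm (h1.symm.trans h2)
  rw [norm_smul, norm_smul, Real.norm_eq_abs, Real.norm_eq_abs, abs_of_nonneg ha,
    abs_of_nonneg (by positivity)] at h3
  linarith

/-- Moderateness bounds the derivatives on the compact unit sphere; dilating by `c = |x|` transports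
the bound to `x` with the factor `|x|^(α-n)`, which is at most `|x|^α` where `|x| ≥ 1`. -/
theorem IsModerate.exists_hasBound_homExtension (hu : IsModerate (punctured d) u) (n : ℕ) :
    ∃ N : ℕ, HasBound (punctured d) {x | 1 ≤ ‖x‖} n
      (fun ε x => ((ε : ℝ) ^ N)⁻¹ * (1 + ‖x‖) ^ N) (Colombeau.homExtension α u) := by
  have hsph : Metric.sphere (0 : Eu d) 1 ⊆ punctured d := fun x hx h0 => by
    have : x = 0 := h0
    simp [this] at hx
  obtain ⟨N, C, hC⟩ := (hu.homExtension (α := α)).2 _ (isCompact_sphere 0 1) hsph n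
  obtain ⟨M, hM⟩ := exists_nat_ge α
  -- `N` absorbs the growth in `1/ε` and `M ≥ α` the growth in `|x|`; their sum is one exponent for
  -- both.
  refine ⟨N + M, |C|, hC.mono fun ε hε x (hx : 1 ≤ ‖x‖) => ?_⟩
  have hε0 := ε.2.1
  have hx0 : 0 < ‖x‖ := by linarith
  have hxΩ : x ∈ punctured d := norm_pos_iff.1 hx0
  have hyS : ‖x‖⁻¹ • x ∈ Metric.sphere (0 : Eu d) 1 := by
    simp [norm_smul, hx0.ne']
  have h1 := hε _ hyS
  rw [iteratedFDerivWithin_of_isOpen n (punctured d).isOpen (hsph hyS)] at h1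
  rw [iteratedFDerivWithin_of_isOpen n (punctured d).isOpen hxΩ]
  have h2 := norm_iteratedFDeriv_smul_of_homogeneous hx0 (Real.rpow_nonneg hx0.le α)
    (fun y => homExtension_smul (u := u) hx0 ε y) (n := n) (x := ‖x‖⁻¹ • x)
    ((((hu.homExtension (α := α)).1 ε).contDiffAt ((punctured d).isOpen.mem_nhds (hsph hyS))).of_le
      (by exact_mod_cast le_top))
  rw [smul_inv_smul₀ hx0.ne'] at h2
  have h3 : ‖x‖ ^ α ≤ (1 + ‖x‖) ^ (N + M) := by
    calc ‖x‖ ^ α ≤ ‖x‖ ^ (M : ℝ) := Real.rpow_le_rpow_of_exponent_le hx hM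
      _ = ‖x‖ ^ M := Real.rpow_natCast _ _
      _ ≤ (1 + ‖x‖) ^ M := pow_le_pow_left₀ hx0.le (by linarith) _
      _ ≤ _ := pow_le_pow_right₀ (by linarith) (by omega)
  have h4 : ((ε : ℝ) ^ N)⁻¹ ≤ ((ε : ℝ) ^ (N + M))⁻¹ := idx_inv_pow_le ε (by omega)
  calc ‖iteratedFDeriv ℝ n (Colombeau.homExtension α u ε) x‖
      ≤ ‖iteratedFDeriv ℝ n (Colombeau.homExtension α u ε) x‖ * ‖x‖ ^ n :=
        le_mul_of_one_le_right (norm_nonneg _) (one_le_pow₀ hx)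
    _ = ‖x‖ ^ α * ‖iteratedFDeriv ℝ n (Colombeau.homExtension α u ε) (‖x‖⁻¹ • x)‖ := h2
    _ ≤ (1 + ‖x‖) ^ (N + M) * (|C| * ((ε : ℝ) ^ (N + M))⁻¹) := by
        refine mul_le_mul h3 (h1.trans ?_) (norm_nonneg _) (by positivity)
        exact mul_le_mul (le_abs_self C) h4 (by positivity) (abs_nonneg C)
    _ = _ := by ring

/-! ### Cutoff at the origin and gluing -/

/-- A smooth function vanishing on the unit ball and equal to `1` outside the ball of radius `2`. -/
theorem exists_smooth_outer_cutoff (d : ℕ) : ∃ χ : Eu d → ℂ, ContDiff ℝ ∞ χ ∧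
    (∀ x, ‖x‖ < 1 → χ x = 0) ∧ ∀ x, 2 < ‖x‖ → χ x = 1 := by
  let b : ContDiffBump (0 : Eu d) := ⟨1, 2, by norm_num, by norm_num⟩
  refine ⟨fun x => ((1 - b x : ℝ) : ℂ),
    Complex.ofRealCLM.contDiff.comp (contDiff_const.sub b.contDiff), fun x hx => ?_, fun x hx => ?_⟩
  · have : b x = 1 := b.one_of_mem_closedBall (by simpa [b] using hx.le)
    simp [this]
  · have : b x = 0 := b.zero_of_le_dist (by simpa [b] using hx.le)
    simp [this]

/-- Multiplication by a cutoff vanishing near the origin turns a negligible net on `ℝ^d ∖ {0}` into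
a negligible net on `ℝ^d`. -/
theorem IsNegligible.cutoff_mul (hu : IsNegligible (punctured d) u) {χ : Eu d → ℂ}
    (hχ : ContDiff ℝ ∞ χ) (h0 : ∀ x, ‖x‖ < 1 → χ x = 0) :
    IsNegligible (⊤ : Opens (Eu d)) ((fun _ => χ) * u) := by
  have hp : IsNegligible (punctured d) ((fun _ => χ) * u) :=
    (isModerate_of_contDiffOn hχ.contDiffOn).mul_negligible hu
  -- The values of `u` at the origin are uncontrolled, but the product vanishes on the whole open
  -- unit ball, hence so do all its derivatives there.
  have hz : ∀ ε : Idx, ∀ x : Eu d, ‖x‖ < 1 → ((fun _ => χ) * u : Net d) ε =ᶠ[𝓝 x] fun _ => 0 := by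
    intro ε x hx
    filter_upwards [(isOpen_lt continuous_norm continuous_const).mem_nhds hx] with y hy
    simp [h0 y hy]
  refine ⟨fun ε x _ => ?_, fun S hS _ n m => ?_⟩
  · refine ContDiffAt.contDiffWithinAt ?_
    rcases lt_or_ge ‖x‖ 1 with hx | hx
    · exact contDiffAt_const.congr_of_eventuallyEq (hz ε x hx)
    · have hx' : x ∈ punctured d := norm_pos_iff.1 (by linarith)
      exact (hp.1 ε).contDiffAt ((punctured d).isOpen.mem_nhds hx')
  -- Only the part of `S` with `|x| ≥ 1` contributes, and it is a compact subset of the punctured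
  -- space.
  · have hS' : IsCompact (S ∩ {x | 1 ≤ ‖x‖}) :=
      hS.inter_right (isClosed_le continuous_const continuous_norm)
    have hSΩ : S ∩ {x | 1 ≤ ‖x‖} ⊆ punctured d := fun x hx =>
      norm_pos_iff.1 (lt_of_lt_of_le one_pos hx.2)
    obtain ⟨C, hC⟩ := (hp.2 _ hS' hSΩ n m).congr_opens (Ω' := ⊤) hSΩ (fun _ _ => trivial)
    refine ⟨|C|, hC.mono fun ε hε x hx => ?_⟩
    have hε0 := pow_nonneg ε.2.1.le m
    rcases lt_or_ge ‖x‖ 1 with hx1 | hx1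
    · rw [iteratedFDerivWithin_of_isOpen n (⊤ : Opens (Eu d)).isOpen trivial,
        ((hz ε x hx1).iteratedFDeriv ℝ n).eq_of_nhds]
      simpa using mul_nonneg (abs_nonneg C) hε0
    · exact (hε x ⟨hx, hx1⟩).trans (mul_le_mul_of_nonneg_right (le_abs_self C) hε0)

/-- A moderate net on `ℝ^d` that satisfies tempered estimates outside a ball is tempered. -/
theorem IsModerate.isTemperedModerate_of_outside (hu : IsModerate (⊤ : Opens (Eu d)) u) (R : ℝ)
    (h : ∀ n : ℕ, ∃ N : ℕ, HasBound (⊤ : Opens (Eu d)) {x | R < ‖x‖} n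
      (fun ε x => ((ε : ℝ) ^ N)⁻¹ * (1 + ‖x‖) ^ N) u) :
    IsTemperedModerate (⊤ : Opens (Eu d)) u := by
  refine ⟨hu.1, fun n => ?_⟩
  obtain ⟨N, C, hC⟩ := h n
  obtain ⟨M, D, hD⟩ := hu.2 (Metric.closedBall 0 R) (isCompact_closedBall 0 R)
    (fun _ _ => trivial) n
  refine ⟨N + M, max |C| |D|, ?_⟩
  filter_upwards [hC, hD] with ε h1 h2 x _
  have hε := ε.2.1
  have hx1 : 1 ≤ 1 + ‖x‖ := by linarith [norm_nonneg x]
  rcases lt_or_ge R ‖x‖ with hx | hx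
  · refine (h1 x hx).trans (mul_le_mul ((le_abs_self C).trans (le_max_left _ _)) ?_
      (by positivity) (by positivity))
    exact mul_le_mul (idx_inv_pow_le ε (by omega)) (pow_le_pow_right₀ hx1 (by omega))
      (by positivity) (by positivity)
  · refine (h2 x (by simpa using hx)).trans (mul_le_mul ((le_abs_self D).trans (le_max_right _ _)) ?_
      (by positivity) (by positivity))
    exact (idx_inv_pow_le ε (by omega)).trans (le_mul_of_one_le_right (by positivity)
      (one_le_pow₀ hx1))

/-- Transfers homogeneity from classes to representatives: the difference of the two sides is
represented definitionally by the defect net. -/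
theorem G.mk_isHomogeneous_iff (hΩ : IsCone Ω) (w : moderate Ω) :
    G.IsHomogeneous hΩ (Ideal.Quotient.mk (negligible Ω) w) α ↔
      ∀ c : ℝ, 0 < c → IsNegligible Ω (homDefect α c (w : Net d)) := by
  refine forall₂_congr fun c hc => ?_
  exact Ideal.Quotient.eq

end Colombeau

theorem mainTheorem3 (d : ℕ) (hd : 1 ≤ d) (α : ℝ) :
    (∀ u : Colombeau.G (Colombeau.punctured d),
      Colombeau.G.IsHomogeneous (Colombeau.isCone_punctured d) u α →
        u = Colombeau.G.radialProj u * Colombeau.normPow d α) ∧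
    (∀ u : Colombeau.G (⊤ : TopologicalSpace.Opens (Colombeau.Eu d)),
      Colombeau.G.IsHomogeneous (Colombeau.isCone_univ d) u α →
        ∃ v : Colombeau.Gτ (⊤ : TopologicalSpace.Opens (Colombeau.Eu d)),
          Colombeau.K (⊤ : TopologicalSpace.Opens (Colombeau.Eu d)) v = u) := by
  open Colombeau in
  refine ⟨fun u hu => ?_, fun u hu => ?_⟩
  · obtain ⟨w, rfl⟩ := Ideal.Quotient.mk_surjective u
    rw [G.mk_isHomogeneous_iff] at hu
    exact Ideal.Quotient.eq.2 (isNegligible_sub_homExtension w.2 hu)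
  · obtain ⟨w, rfl⟩ := Ideal.Quotient.mk_surjective u
    rw [G.mk_isHomogeneous_iff] at hu
    have hw : IsModerate (punctured d) (w : Net d) := IsModerate.restrict w.2 le_top
    obtain ⟨χ, hχ, hχ0, hχ1⟩ := exists_smooth_outer_cutoff d
    have hn : IsNegligible (⊤ : Opens (Eu d))
        ((fun _ => χ) * ((w : Net d) - homExtension α (w : Net d))) :=
      (isNegligible_sub_homExtension hw fun c hc => (hu c hc).restrict le_top).cutoff_mul hχ hχ0
    -- This net agrees with `homExtension α w` where `χ = 1`, so the growth estimates for the latter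
    -- apply outside radius `2`; the ball inside is handled by moderateness.
    have hv : IsTemperedModerate (⊤ : Opens (Eu d))
        ((w : Net d) - (fun _ => χ) * ((w : Net d) - homExtension α (w : Net d))) := by
      refine (IsModerate.sub w.2 hn.isModerate).isTemperedModerate_of_outside 2 fun n => ?_
      obtain ⟨N, C, hC⟩ := hw.exists_hasBound_homExtension (α := α) n
      refine ⟨N, C, hC.mono fun ε hε x (hx : 2 < ‖x‖) => ?_⟩
      have hx1 : 1 ≤ ‖x‖ := by linarith
      refine le_of_eq_of_le (congrArg norm ?_) (hε x hx1)
      rw [iteratedFDerivWithin_of_isOpen n (⊤ : Opens (Eu d)).isOpen trivial,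
        iteratedFDerivWithin_of_isOpen n (punctured d).isOpen
          (norm_pos_iff.1 (zero_lt_two.trans hx) : x ≠ 0)]
      -- Equality near `x`, not just at `x`, is needed to compare derivatives; the strict inequality
      -- `2 < ‖x‖` provides it.
      refine (EventuallyEq.iteratedFDeriv ℝ ?_ n).eq_of_nhds
      filter_upwards [(isOpen_lt continuous_const continuous_norm).mem_nhds hx] with y hy
      simp [hχ1 y hy]
    refine ⟨Ideal.Quotient.mk _ ⟨_, hv⟩, ?_⟩
    refine Eq.symm (Ideal.Quotient.eq.2 ?_)
    change IsNegligible _ _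
    convert hn using 1
    exact sub_sub_cancel _ _
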